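/- Let $\Omega$ be an arbitrary set, $\mathcal A$ an algebra of subsets of $\Omega$, and $ba(\mathcal A)$ the vector space of bounded, finitely additive set functions $\mu:\mathcal A\to\mathbb R$. For $\mu\in ba(\mathcal A)$ let $|\mu|\in ba(\mathcal A)$ denote its total variation, $|\mu|(A)=\sup\sum_{i=1}^n|\mu(E_i)|$ over all finite families of pairwise disjoint $E_i\in\mathcal A$ with $E_i\subseteq A$. A function $f:\Omega\to\mathbb R$ is $\mu$-integrable (in the sense of Dunford and Schwartz) if there are $\mathcal A$-simple functions $f_n$ that converge to $f$ in $|\mu|$-measure, that is $|\mu|^*(|f_n-f|>\varepsilon)\to0$ for every $\varepsilon>0$, where $|\mu|^*(S)=\inf\{|\mu|(A):S\subseteq A\in\mathcal A\}$, and satisfy $\int|f_m-f_n|\,d|\mu|\to0$ as $m,n\to\infty$; then $\mu(f)=\int f\,d\mu:=\lim_n\int f_n\,d\mu$, which does not depend on the choice of $(f_n)$. Fix $\lambda\in ba(\mathcal A)$. Let $L^1(\lambda)$ be the normed space of $\lambda$-integrable functions, functions $f,g$ with $\int|f-g|\,d|\lambda|=0$ being identified, with norm $\|f\|=\int|f|\,d|\lambda|$,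 and let $$ba_\infty(\mathcal A,\lambda)=\{\mu\in ba(\mathcal A):|\mu|\le c|\lambda|\text{ for some }c>0\}.$$ Then there is a linear isomorphism $\varphi\mapsto\mu$ of the dual space $L^1(\lambda)^*$ (the continuous linear functionals) onto $ba_\infty(\mathcal A,\lambda)$ such that, for corresponding $\varphi$ and $\mu$, every $f\in L^1(\lambda)$ is $\mu$-integrable and $$\varphi(f)=\mu(f)\qquad (f\in L^1(\lambda)).$$ The isomorphism is isometric when $ba_\infty(\mathcal A,\lambda)$ carries the norm $\min\{c\ge0:|\mu|\le c|\lambda|\}$, that is, $\|\varphi\|$ is the least $c\ge 0$ with $|\mu|\le c|\lambda|$. -/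

import Mathlib

open Filter Topology

noncomputable section

namespace FinAdd

/-! Bounded finitely additive set functions on an algebra of sets. An algebra of subsets of `Ω` is
a `BooleanSubalgebra (Set Ω)`; its lattice operations are union, intersection and complement. -/

section ba

variable {Ω : Type*}

/-- `ba 𝒜`: the real, bounded, finitely additive set functions on the algebra `𝒜`. -/
def ba (𝒜 : BooleanSubalgebra (Set Ω)) : Submodule ℝ (𝒜 → ℝ) where
  carrier := {μ | (∀ A B : 𝒜, Disjoint A B → μ (A ⊔ B) = μ A + μ B) ∧ ∃ C : ℝ, ∀ A, |μ A| ≤ C}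
  add_mem' := by
    rintro μ ν ⟨hμ, C, hC⟩ ⟨hν, D, hD⟩
    refine ⟨fun A B h => ?_, C + D, fun A => (abs_add_le _ _).trans (add_le_add (hC A) (hD A))⟩
    simp only [Pi.add_apply, hμ A B h, hν A B h]
    ring
  zero_mem' := ⟨fun A B _ => by simp, 0, fun A => by simp⟩
  smul_mem' := by
    rintro c μ ⟨hμ, C, hC⟩
    refine ⟨fun A B h => ?_, |c| * C, fun A => ?_⟩
    · simp only [Pi.smul_apply, hμ A B h, smul_eq_mul]
      ring
    · simp only [Pi.smul_apply, smul_eq_mul, abs_mul]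
      exact mul_le_mul_of_nonneg_left (hC A) (abs_nonneg c)

variable {𝒜 : BooleanSubalgebra (Set Ω)}

/-- The sums `∑ i, |μ (E i)|` over the finite families of pairwise disjoint members of `𝒜`
contained in `A`. -/
def variationSums (μ : 𝒜 → ℝ) (A : 𝒜) : Set ℝ :=
  {r | ∃ (n : ℕ) (E : Fin n → 𝒜), Pairwise (fun i j => Disjoint (E i) (E j)) ∧
    (∀ i, E i ≤ A) ∧ r = ∑ i, |μ (E i)|}

/-- Values of the total variation, `|μ|(A) = sup ∑ i, |μ (E i)|`. -/
def variationFun (μ : 𝒜 → ℝ) (A : 𝒜) : ℝ := sSup (variationSums μ A)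

lemma ba_bot (μ : ba 𝒜) : μ.1 ⊥ = 0 := by
  have h := μ.2.1 ⊥ ⊥ disjoint_bot_left
  simpa using h

lemma ba_sup {ι : Type*} (μ : ba 𝒜) (s : Finset ι) (E : ι → 𝒜)
    (hE : ∀ i ∈ s, ∀ j ∈ s, i ≠ j → Disjoint (E i) (E j)) :
    μ.1 (s.sup E) = ∑ i ∈ s, μ.1 (E i) := by
  classical
  induction s using Finset.induction_on with
  | empty => simpa using ba_bot μ
  | insert a s ha ih =>
    rw [Finset.sup_insert, Finset.sum_insert ha, μ.2.1, ih]
    · exact fun i hi j hj => hE i (Finset.mem_insert_of_mem hi) j (Finset.mem_insert_of_mem hj)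
    · rw [Finset.disjoint_sup_right]
      exact fun i hi => hE a (Finset.mem_insert_self _ _) i (Finset.mem_insert_of_mem hi)
        (fun h => ha (h ▸ hi))

lemma ba_sum_abs_le {ι : Type*} [Fintype ι] (μ : ba 𝒜) (C : ℝ) (hC : ∀ A, |μ.1 A| ≤ C)
    (E : ι → 𝒜) (hE : Pairwise fun i j => Disjoint (E i) (E j)) :
    ∑ i, |μ.1 (E i)| ≤ C + C := by
  classical
  rw [← Finset.sum_filter_add_sum_filter_not Finset.univ (fun i => 0 ≤ μ.1 (E i))]
  refine add_le_add ?_ ?_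
  · rw [Finset.sum_congr rfl (g := fun i => μ.1 (E i)), ← ba_sup]
    · exact (le_abs_self _).trans (hC _)
    · exact fun i _ j _ h => hE h
    · intro i hi
      exact abs_of_nonneg (Finset.mem_filter.1 hi).2
  · rw [Finset.sum_congr rfl (g := fun i => -μ.1 (E i)), Finset.sum_neg_distrib, ← ba_sup]
    · exact (neg_le_abs _).trans (hC _)
    · exact fun i _ j _ h => hE h
    · intro i hi
      exact abs_of_nonpos (not_le.1 (Finset.mem_filter.1 hi).2).le

lemma variationSums_bddAbove (μ : ba 𝒜) (A : 𝒜) : BddAbove (variationSums μ.1 A) := by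
  obtain ⟨C, hC⟩ := μ.2.2
  refine ⟨C + C, ?_⟩
  rintro r ⟨n, E, hE, -, rfl⟩
  exact ba_sum_abs_le μ C hC E hE

lemma zero_mem_variationSums (μ : 𝒜 → ℝ) (A : 𝒜) : (0 : ℝ) ∈ variationSums μ A :=
  ⟨0, Fin.elim0, fun i => i.elim0, fun i => i.elim0, by simp⟩

lemma le_variationFun (μ : ba 𝒜) (A : 𝒜) {n : ℕ} (E : Fin n → 𝒜)
    (hE : Pairwise fun i j => Disjoint (E i) (E j)) (hA : ∀ i, E i ≤ A) :
    ∑ i, |μ.1 (E i)| ≤ variationFun μ.1 A :=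
  le_csSup (variationSums_bddAbove μ A) ⟨n, E, hE, hA, rfl⟩

lemma variationFun_le (μ : 𝒜 → ℝ) (A : 𝒜) (c : ℝ)
    (h : ∀ (n : ℕ) (E : Fin n → 𝒜), Pairwise (fun i j => Disjoint (E i) (E j)) →
      (∀ i, E i ≤ A) → ∑ i, |μ (E i)| ≤ c) : variationFun μ A ≤ c := by
  refine csSup_le ⟨0, zero_mem_variationSums μ A⟩ ?_
  rintro r ⟨n, E, hE, hA, rfl⟩
  exact h n E hE hA

lemma variationFun_nonneg (μ : ba 𝒜) (A : 𝒜) : 0 ≤ variationFun μ.1 A :=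
  le_csSup (variationSums_bddAbove μ A) (zero_mem_variationSums μ.1 A)

lemma abs_le_variationFun (μ : ba 𝒜) (A : 𝒜) : |μ.1 A| ≤ variationFun μ.1 A := by
  simpa using le_variationFun μ A (n := 1) (fun _ => A)
    (fun i j h => absurd (Subsingleton.elim i j) h) (fun _ => le_rfl)

lemma variationFun_sup (μ : ba 𝒜) (A B : 𝒜) (hAB : Disjoint A B) :
    variationFun μ.1 (A ⊔ B) = variationFun μ.1 A + variationFun μ.1 B := by
  apply le_antisymm
  · refine variationFun_le _ _ _ fun n E hE hle => ?_
    calc ∑ i, |μ.1 (E i)| ≤ ∑ i, (|μ.1 (E i ⊓ A)| + |μ.1 (E i ⊓ B)|) := by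
          refine Finset.sum_le_sum fun i _ => ?_
          have h1 : E i = (E i ⊓ A) ⊔ (E i ⊓ B) := by
            rw [← inf_sup_left]; exact (inf_eq_left.2 (hle i)).symm
          have h2 : μ.1 (E i) = μ.1 (E i ⊓ A) + μ.1 (E i ⊓ B) := by
            conv_lhs => rw [h1]
            exact μ.2.1 _ _ (hAB.mono inf_le_right inf_le_right)
          rw [h2]
          exact abs_add_le _ _
      _ = ∑ i, |μ.1 (E i ⊓ A)| + ∑ i, |μ.1 (E i ⊓ B)| := Finset.sum_add_distrib
      _ ≤ _ := add_le_add
          (le_variationFun μ A _ (fun i j h => (hE h).mono inf_le_left inf_le_left)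
            fun i => inf_le_right)
          (le_variationFun μ B _ (fun i j h => (hE h).mono inf_le_left inf_le_left)
            fun i => inf_le_right)
  · rw [← le_sub_iff_add_le]
    refine variationFun_le _ _ _ fun n E hE hA => ?_
    rw [le_sub_comm]
    refine variationFun_le _ _ _ fun m F hF hB => ?_
    rw [le_sub_iff_add_le, add_comm]
    have h := le_variationFun μ (A ⊔ B) (Fin.append E F) ?_ ?_
    · rw [Fin.sum_univ_add] at h
      simpa using h
    · intro i j
      refine Fin.addCases (fun i' => ?_) (fun i' => ?_) i <;>
        refine Fin.addCases (fun j' => ?_) (fun j' => ?_) j <;> intro h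
      · simpa using hE (fun h' => h (by rw [h']))
      · simpa using hAB.mono (hA i') (hB j')
      · simpa using (hAB.mono (hA j') (hB i')).symm
      · simpa using hF (fun h' => h (by rw [h']))
    · intro i
      refine Fin.addCases (fun i' => ?_) (fun i' => ?_) i
      · simpa using (hA i').trans le_sup_left
      · simpa using (hB i').trans le_sup_right

/-- The total variation `|μ|`, again a member of `ba 𝒜`. -/
def variation (μ : ba 𝒜) : ba 𝒜 :=
  ⟨variationFun μ.1, variationFun_sup μ, by
    obtain ⟨C, hC⟩ := μ.2.2
    refine ⟨C + C, fun A => ?_⟩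
    rw [abs_of_nonneg (variationFun_nonneg μ A)]
    exact variationFun_le _ _ _ fun n E hE _ => ba_sum_abs_le μ C hC E hE⟩

lemma variation_nonneg (μ : ba 𝒜) (A : 𝒜) : 0 ≤ (variation μ).1 A := variationFun_nonneg μ A

lemma variation_mono (μ : ba 𝒜) {A B : 𝒜} (h : A ≤ B) :
    (variation μ).1 A ≤ (variation μ).1 B :=
  variationFun_le _ _ _ fun _ E hE hA => le_variationFun μ B E hE fun i => (hA i).trans h

lemma variation_of_nonneg (μ : ba 𝒜) (h0 : ∀ A, 0 ≤ μ.1 A) : variation μ = μ := by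
  apply Subtype.ext
  funext A
  apply le_antisymm
  · refine variationFun_le _ _ _ fun n E hE hA => ?_
    rw [Finset.sum_congr rfl fun i _ => abs_of_nonneg (h0 (E i)),
      ← ba_sup μ Finset.univ E fun i _ j _ h => hE h]
    set F := Finset.univ.sup E with hF
    have h1 : F ⊔ A \ F = A := sup_sdiff_cancel_right (Finset.sup_le fun i _ => hA i)
    have h2 := μ.2.1 F (A \ F) disjoint_sdiff_self_right
    rw [h1] at h2
    linarith [h0 (A \ F)]
  · exact (le_abs_self _).trans (abs_le_variationFun μ A)

lemma variation_variation (μ : ba 𝒜) : variation (variation μ) = variation μ :=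
  variation_of_nonneg _ (variation_nonneg μ)

lemma variation_add_le (μ ν : ba 𝒜) (A : 𝒜) :
    (variation (μ + ν)).1 A ≤ (variation μ).1 A + (variation ν).1 A := by
  refine variationFun_le _ _ _ fun n E hE hA => ?_
  calc ∑ i, |(μ + ν).1 (E i)| ≤ ∑ i, (|μ.1 (E i)| + |ν.1 (E i)|) :=
        Finset.sum_le_sum fun i _ => abs_add_le _ _
    _ = ∑ i, |μ.1 (E i)| + ∑ i, |ν.1 (E i)| := Finset.sum_add_distrib
    _ ≤ _ := add_le_add (le_variationFun μ A E hE hA) (le_variationFun ν A E hE hA)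

lemma variation_smul_le (c : ℝ) (μ : ba 𝒜) (A : 𝒜) :
    (variation (c • μ)).1 A ≤ |c| * (variation μ).1 A := by
  refine variationFun_le _ _ _ fun n E hE hA => ?_
  calc ∑ i, |(c • μ).1 (E i)| = |c| * ∑ i, |μ.1 (E i)| := by
        rw [Finset.mul_sum]
        exact Finset.sum_congr rfl fun i _ => abs_mul _ _
    _ ≤ _ := mul_le_mul_of_nonneg_left (le_variationFun μ A E hE hA) (abs_nonneg c)

/-- `ba_∞(𝒜, l)`: the `μ ∈ ba 𝒜` with `|μ| ≤ c |l|` for some `c > 0`. -/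
def baInfty (l : ba 𝒜) : Submodule ℝ (ba 𝒜) where
  carrier := {μ | ∃ c : ℝ, 0 < c ∧ ∀ A, (variation μ).1 A ≤ c * (variation l).1 A}
  add_mem' := by
    rintro μ ν ⟨c, hc, hμ⟩ ⟨d, hd, hν⟩
    refine ⟨c + d, add_pos hc hd, fun A => ?_⟩
    linarith [variation_add_le μ ν A, hμ A, hν A]
  zero_mem' := by
    refine ⟨1, one_pos, fun A => ?_⟩
    have h : variation (0 : ba 𝒜) = 0 := variation_of_nonneg 0 fun A => le_rfl
    rw [h, one_mul]
    exact variation_nonneg l A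
  smul_mem' := by
    rintro a μ ⟨c, hc, hμ⟩
    refine ⟨|a| * c + 1, by positivity, fun A => ?_⟩
    have h1 := variation_smul_le a μ A
    have h2 := mul_le_mul_of_nonneg_left (hμ A) (abs_nonneg a)
    have h3 := variation_nonneg l A
    linarith

end ba

/-! Integration with respect to a bounded finitely additive set function, in the sense of
Dunford and Schwartz. -/

section integral

variable {Ω : Type*} {𝒜 : BooleanSubalgebra (Set Ω)}

/-- `𝒜`-simple functions: finitely many values, each taken on a set of `𝒜`. -/
def IsSimple (𝒜 : BooleanSubalgebra (Set Ω)) (f : Ω → ℝ) : Prop :=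
  (Set.range f).Finite ∧ ∀ x, f ⁻¹' {x} ∈ 𝒜

open Classical in
/-- The value `μ S` at a subset `S` of `Ω` (by convention `0` when `S ∉ 𝒜`). -/
def setValue (μ : ba 𝒜) (S : Set Ω) : ℝ := if h : S ∈ 𝒜 then μ.1 ⟨S, h⟩ else 0

/-- The integral `∑ x, x μ(f = x)` of a simple function. -/
def simpleIntegral (μ : ba 𝒜) (f : Ω → ℝ) : ℝ := ∑ᶠ x : ℝ, x * setValue μ (f ⁻¹' {x})

/-- The outer measure `|μ|*(S) = inf {|μ|(A) : S ⊆ A ∈ 𝒜}`. -/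
def outerVariation (μ : ba 𝒜) (S : Set Ω) : ℝ :=
  sInf {r | ∃ A : 𝒜, S ⊆ (A : Set Ω) ∧ r = (variation μ).1 A}

/-- `g` is a fundamental (determining) sequence for `f`: simple functions converging to `f` in
`|μ|`-measure that are Cauchy for `∫ |·| d|μ|`. -/
structure IsFundamental (μ : ba 𝒜) (g : ℕ → Ω → ℝ) (f : Ω → ℝ) : Prop where
  simple : ∀ n, IsSimple 𝒜 (g n)
  tendsto_measure : ∀ ε : ℝ, 0 < ε →
    Tendsto (fun n => outerVariation μ {ω | ε < |g n ω - f ω|}) atTop (𝓝 0)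
  cauchy : ∀ ε : ℝ, 0 < ε → ∃ N, ∀ m ≥ N, ∀ n ≥ N,
    simpleIntegral (variation μ) (fun ω => |g m ω - g n ω|) < ε

/-- `f` is `μ`-integrable. -/
def Integrable (μ : ba 𝒜) (f : Ω → ℝ) : Prop := ∃ g, IsFundamental μ g f

open Classical in
/-- The integral `μ(f) = lim μ(g n)` along a fundamental sequence of `f`; the limit exists and does
not depend on the sequence, see `tendsto_integral`. It is `0` if `f` is not integrable. -/
def integral (μ : ba 𝒜) (f : Ω → ℝ) : ℝ :=
  if h : Integrable μ f then limUnder atTop (fun n => simpleIntegral μ (h.choose n)) else 0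

lemma setValue_coe (μ : ba 𝒜) (A : 𝒜) : setValue μ (A : Set Ω) = μ.1 A := by
  simp [setValue]

lemma coe_finset_sup {ι : Type*} (s : Finset ι) (E : ι → 𝒜) :
    ((s.sup E : 𝒜) : Set Ω) = ⋃ i ∈ s, (E i : Set Ω) := by
  classical
  induction s using Finset.induction_on with
  | empty => simp
  | insert a s ha ih => simp [ih]

lemma disjoint_coe {A B : 𝒜} (h : Disjoint A B) : Disjoint (A : Set Ω) (B : Set Ω) := by
  rw [disjoint_iff] at h ⊢
  exact congrArg Subtype.val h

/-- A function constant on the cells of a finite partition is simple, and its integral can be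
computed along the partition. -/
lemma simple_of_partition {ι : Type*} [Fintype ι] (E : ι → 𝒜)
    (hE : Pairwise fun i j => Disjoint (E i) (E j)) (hcov : ∀ ω, ∃ i, ω ∈ (E i : Set Ω))
    (c : ι → ℝ) (f : Ω → ℝ) (hf : ∀ i, ∀ ω ∈ (E i : Set Ω), f ω = c i) :
    IsSimple 𝒜 f ∧ ∀ μ : ba 𝒜, simpleIntegral μ f = ∑ i, c i * μ.1 (E i) := by
  classical
  have hpre : ∀ x, f ⁻¹' {x} = (((Finset.univ.filter fun i => c i = x).sup E : 𝒜) : Set Ω) := by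
    intro x
    rw [coe_finset_sup]
    ext ω
    simp only [Set.mem_preimage, Set.mem_singleton_iff, Finset.mem_filter, Finset.mem_univ,
      true_and, Set.mem_iUnion, exists_prop]
    constructor
    · intro h
      obtain ⟨i, hi⟩ := hcov ω
      exact ⟨i, (hf i ω hi).symm.trans h, hi⟩
    · rintro ⟨i, hi, hω⟩
      exact (hf i ω hω).trans hi
  refine ⟨⟨?_, fun x => ?_⟩, fun μ => ?_⟩
  · refine (Set.finite_range c).subset ?_
    rintro _ ⟨ω, rfl⟩
    obtain ⟨i, hi⟩ := hcov ω
    exact ⟨i, (hf i ω hi).symm⟩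
  · rw [hpre x]
    exact Subtype.mem _
  · have hval : ∀ x, x * setValue μ (f ⁻¹' {x}) =
        ∑ i ∈ Finset.univ.filter (fun i => c i = x), c i * μ.1 (E i) := by
      intro x
      rw [hpre x, setValue_coe, ba_sup μ _ E fun i _ j _ h => hE h, Finset.mul_sum]
      exact Finset.sum_congr rfl fun i hi => by rw [(Finset.mem_filter.1 hi).2]
    unfold simpleIntegral
    rw [finsum_congr hval, finsum_eq_sum_of_support_subset (s := Finset.univ.image c),
      Finset.sum_fiberwise_of_maps_to]
    · exact fun i _ => Finset.mem_image_of_mem _ (Finset.mem_univ i)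
    · intro x hx
      obtain ⟨i, hi, -⟩ := Finset.exists_ne_zero_of_sum_ne_zero hx
      exact Finset.mem_coe.2 (Finset.mem_image.2 ⟨i, Finset.mem_univ i, (Finset.mem_filter.1 hi).2⟩)

/-- Two simple functions are constant on the cells of a common finite partition. -/
lemma exists_partition {f g : Ω → ℝ} (hf : IsSimple 𝒜 f) (hg : IsSimple 𝒜 g) :
    ∃ (ι : Type) (_ : Fintype ι) (E : ι → 𝒜) (c d : ι → ℝ),
      (Pairwise fun i j => Disjoint (E i) (E j)) ∧ (∀ ω, ∃ i, ω ∈ (E i : Set Ω)) ∧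
      (∀ i, ∀ ω ∈ (E i : Set Ω), f ω = c i) ∧ (∀ i, ∀ ω ∈ (E i : Set Ω), g ω = d i) := by
  classical
  have : Fintype ↥(Set.range f) := hf.1.fintype
  have : Fintype ↥(Set.range g) := hg.1.fintype
  refine ⟨Set.range f × Set.range g, inferInstance,
    fun p => ⟨f ⁻¹' {p.1.1} ⊓ g ⁻¹' {p.2.1},
      BooleanSubalgebra.inf_mem (hf.2 _) (hg.2 _)⟩, fun p => p.1.1, fun p => p.2.1,
    ?_, ?_, ?_, ?_⟩
  · intro p q hpq
    rw [disjoint_iff]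
    apply Subtype.ext
    ext ω
    simp only [BooleanSubalgebra.val_inf, BooleanSubalgebra.val_bot]
    constructor
    · rintro ⟨⟨h1, h2⟩, h3, h4⟩
      refine (hpq (Prod.ext (Subtype.ext ?_) (Subtype.ext ?_))).elim
      · exact (show f ω = _ from h1).symm.trans h3
      · exact (show g ω = _ from h2).symm.trans h4
    · exact fun h => h.elim
  · exact fun ω => ⟨(⟨f ω, ω, rfl⟩, ⟨g ω, ω, rfl⟩), rfl, rfl⟩
  · exact fun p ω h => h.1
  · exact fun p ω h => h.2

lemma IsSimple.comp₂ {f g : Ω → ℝ} (hf : IsSimple 𝒜 f) (hg : IsSimple 𝒜 g) (F : ℝ → ℝ → ℝ) :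
    IsSimple 𝒜 (fun ω => F (f ω) (g ω)) := by
  obtain ⟨ι, _, E, c, d, hE, hcov, hc, hd⟩ := exists_partition hf hg
  exact (simple_of_partition E hE hcov (fun i => F (c i) (d i)) _
    fun i ω h => by rw [hc i ω h, hd i ω h]).1

lemma simpleIntegral_add (μ : ba 𝒜) {f g : Ω → ℝ} (hf : IsSimple 𝒜 f) (hg : IsSimple 𝒜 g) :
    simpleIntegral μ (fun ω => f ω + g ω) = simpleIntegral μ f + simpleIntegral μ g := by
  obtain ⟨ι, _, E, c, d, hE, hcov, hc, hd⟩ := exists_partition hf hg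
  rw [(simple_of_partition E hE hcov (fun i => c i + d i) _
      fun i ω h => by rw [hc i ω h, hd i ω h]).2,
    (simple_of_partition E hE hcov c f hc).2, (simple_of_partition E hE hcov d g hd).2,
    ← Finset.sum_add_distrib]
  exact Finset.sum_congr rfl fun i _ => add_mul _ _ _

lemma simpleIntegral_const_mul (μ : ba 𝒜) (a : ℝ) {f : Ω → ℝ} (hf : IsSimple 𝒜 f) :
    simpleIntegral μ (fun ω => a * f ω) = a * simpleIntegral μ f := by
  obtain ⟨ι, _, E, c, d, hE, hcov, hc, hd⟩ := exists_partition hf hf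
  rw [(simple_of_partition E hE hcov (fun i => a * c i) _
      fun i ω h => by rw [hc i ω h]).2, (simple_of_partition E hE hcov c f hc).2, Finset.mul_sum]
  exact Finset.sum_congr rfl fun i _ => mul_assoc _ _ _

lemma simpleIntegral_mono (μ : ba 𝒜) (h0 : ∀ A, 0 ≤ μ.1 A) {f g : Ω → ℝ} (hf : IsSimple 𝒜 f)
    (hg : IsSimple 𝒜 g) (h : ∀ ω, f ω ≤ g ω) : simpleIntegral μ f ≤ simpleIntegral μ g := by
  obtain ⟨ι, _, E, c, d, hE, hcov, hc, hd⟩ := exists_partition hf hg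
  rw [(simple_of_partition E hE hcov c f hc).2, (simple_of_partition E hE hcov d g hd).2]
  refine Finset.sum_le_sum fun i _ => ?_
  rcases Set.eq_empty_or_nonempty (E i : Set Ω) with he | ⟨ω, hω⟩
  · have : E i = ⊥ := Subtype.ext he
    rw [this, ba_bot]
    simp
  · refine mul_le_mul_of_nonneg_right ?_ (h0 _)
    rw [← hc i ω hω, ← hd i ω hω]
    exact h ω

lemma abs_simpleIntegral_le (μ : ba 𝒜) {f : Ω → ℝ} (hf : IsSimple 𝒜 f) :
    |simpleIntegral μ f| ≤ simpleIntegral (variation μ) (fun ω => |f ω|) := by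
  obtain ⟨ι, _, E, c, d, hE, hcov, hc, hd⟩ := exists_partition hf hf
  rw [(simple_of_partition E hE hcov c f hc).2, (simple_of_partition E hE hcov (fun i => |c i|) _
      fun i ω h => by rw [hc i ω h]).2]
  refine (Finset.abs_sum_le_sum_abs _ _).trans (Finset.sum_le_sum fun i _ => ?_)
  rw [abs_mul]
  exact mul_le_mul_of_nonneg_left (abs_le_variationFun μ _) (abs_nonneg _)

open Classical in
/-- The step function with values `a` on `A` and `b` off `A`. -/
lemma simple_ite (A : 𝒜) (a b : ℝ) :
    IsSimple 𝒜 (fun ω => if ω ∈ (A : Set Ω) then a else b) ∧ ∀ μ : ba 𝒜,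
      simpleIntegral μ (fun ω => if ω ∈ (A : Set Ω) then a else b) = a * μ.1 A + b * μ.1 Aᶜ := by
  have h := simple_of_partition (fun i : Bool => if i then A else Aᶜ) ?_ ?_
    (fun i : Bool => if i then a else b) (fun ω => if ω ∈ (A : Set Ω) then a else b) ?_
  · refine ⟨h.1, fun μ => ?_⟩
    rw [h.2]
    simp
  · intro i j hij
    cases i <;> cases j <;> simp_all [disjoint_compl_left, disjoint_compl_right]
  · intro ω
    by_cases hω : ω ∈ (A : Set Ω)
    · exact ⟨true, by simpa using hω⟩
    · exact ⟨false, by simpa using hω⟩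
  · intro i ω
    cases i <;> simp +contextual

lemma outerVariation_nonneg (μ : ba 𝒜) (S : Set Ω) : 0 ≤ outerVariation μ S :=
  Real.sInf_nonneg (by rintro r ⟨A, -, rfl⟩; exact variation_nonneg μ A)

lemma outerVariation_le (μ : ba 𝒜) {S : Set Ω} {A : 𝒜} (h : S ⊆ (A : Set Ω)) :
    outerVariation μ S ≤ (variation μ).1 A :=
  csInf_le ⟨0, by rintro r ⟨A, -, rfl⟩; exact variation_nonneg μ A⟩ ⟨A, h, rfl⟩

lemma exists_outerVariation_lt (μ : ba 𝒜) (S : Set Ω) {ε : ℝ} (hε : 0 < ε) :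
    ∃ A : 𝒜, S ⊆ (A : Set Ω) ∧ (variation μ).1 A < outerVariation μ S + ε := by
  have hne : {r | ∃ A : 𝒜, S ⊆ (A : Set Ω) ∧ r = (variation μ).1 A}.Nonempty :=
    ⟨_, ⊤, by simp, rfl⟩
  obtain ⟨r, ⟨A, hA, rfl⟩, hr⟩ := exists_lt_of_csInf_lt hne (lt_add_of_pos_right _ hε)
  exact ⟨A, hA, hr⟩

lemma variation_le_outerVariation (μ : ba 𝒜) (A : 𝒜) :
    (variation μ).1 A ≤ outerVariation μ (A : Set Ω) := by
  refine le_csInf ⟨_, A, subset_rfl, rfl⟩ ?_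
  rintro r ⟨B, hB, rfl⟩
  exact variation_mono μ hB

lemma outerVariation_le_add (μ : ba 𝒜) {S T U : Set Ω} (h : S ⊆ T ∪ U) :
    outerVariation μ S ≤ outerVariation μ T + outerVariation μ U := by
  refine le_of_forall_pos_le_add fun ε hε => ?_
  obtain ⟨A, hA, hA'⟩ := exists_outerVariation_lt μ T (half_pos hε)
  obtain ⟨B, hB, hB'⟩ := exists_outerVariation_lt μ U (half_pos hε)
  have h1 : outerVariation μ S ≤ (variation μ).1 (A ⊔ B) :=
    outerVariation_le μ (h.trans (Set.union_subset_union hA hB))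
  have h2 : (variation μ).1 (A ⊔ B) ≤ (variation μ).1 A + (variation μ).1 B := by
    have e : A ⊔ B \ A = A ⊔ B := sup_sdiff_self_right A B
    have := (variation μ).2.1 A (B \ A) disjoint_sdiff_self_right
    rw [e] at this
    rw [this]
    linarith [variation_mono μ (sdiff_le : B \ A ≤ B)]
  linarith

lemma IsFundamental.comp₂ {μ : ba 𝒜} {g g' : ℕ → Ω → ℝ} {f f' : Ω → ℝ}
    (h : IsFundamental μ g f) (h' : IsFundamental μ g' f') (F : ℝ → ℝ → ℝ) (K : ℝ) (hK : 0 < K)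
    (hF : ∀ a b c d, |F a b - F c d| ≤ K * (|a - c| + |b - d|)) :
    IsFundamental μ (fun n ω => F (g n ω) (g' n ω)) (fun ω => F (f ω) (f' ω)) where
  simple n := (h.simple n).comp₂ (h'.simple n) F
  tendsto_measure ε hε := by
    have hδ : 0 < ε / (2 * K) := by positivity
    have hs := (h.tendsto_measure _ hδ).add (h'.tendsto_measure _ hδ)
    rw [add_zero] at hs
    refine squeeze_zero (fun n => outerVariation_nonneg μ _) (fun n => ?_) hs
    refine outerVariation_le_add μ fun ω hω => ?_
    by_contra hcon
    simp only [Set.mem_union, Set.mem_ofPred_eq, not_or, not_lt] at hcon hω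
    have h1 := hF (g n ω) (g' n ω) (f ω) (f' ω)
    have h2 : K * (|g n ω - f ω| + |g' n ω - f' ω|) ≤ K * (ε / (2 * K) + ε / (2 * K)) :=
      mul_le_mul_of_nonneg_left (add_le_add hcon.1 hcon.2) hK.le
    have h3 : K * (ε / (2 * K) + ε / (2 * K)) = ε := by field_simp; ring
    linarith
  cauchy ε hε := by
    have hδ : 0 < ε / (2 * K) := by positivity
    obtain ⟨N, hN⟩ := h.cauchy _ hδ
    obtain ⟨N', hN'⟩ := h'.cauchy _ hδ
    refine ⟨max N N', fun m hm n hn => ?_⟩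
    have h1 := hN m (le_trans (le_max_left _ _) hm) n (le_trans (le_max_left _ _) hn)
    have h2 := hN' m (le_trans (le_max_right _ _) hm) n (le_trans (le_max_right _ _) hn)
    have s1 := (h.simple m).comp₂ (h.simple n) (fun a b => |a - b|)
    have s2 := (h'.simple m).comp₂ (h'.simple n) (fun a b => |a - b|)
    have s3 := s1.comp₂ s2 (fun a b => a + b)
    have h3 := simpleIntegral_mono (variation μ) (variation_nonneg μ)
      (((h.simple m).comp₂ (h'.simple m) F).comp₂ ((h.simple n).comp₂ (h'.simple n) F)
        (fun a b => |a - b|))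
      (s3.comp₂ s3 (fun a _ => K * a)) (fun ω => hF _ _ _ _)
    rw [simpleIntegral_const_mul _ _ s3, simpleIntegral_add _ s1 s2] at h3
    refine h3.trans_lt ?_
    have h4 : K * (ε / (2 * K) + ε / (2 * K)) = ε := by field_simp; ring
    rw [← h4]
    exact mul_lt_mul_of_pos_left (add_lt_add h1 h2) hK

/-- A fundamental sequence for `0` tends to `0` in mean. -/
lemma IsFundamental.tendsto_zero {μ : ba 𝒜} {h : ℕ → Ω → ℝ} (H : IsFundamental μ h fun _ => 0) :
    Tendsto (fun n => simpleIntegral (variation μ) (fun ω => |h n ω|)) atTop (𝓝 0) := by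
  classical
  have s0 : ∀ n, IsSimple 𝒜 (fun ω => |h n ω|) := fun n =>
    (H.simple n).comp₂ (H.simple n) (fun a _ => |a|)
  set V := (variation μ).1 ⊤ with hV
  have hV0 : 0 ≤ V := variation_nonneg μ ⊤
  have hnn : ∀ n, 0 ≤ simpleIntegral (variation μ) (fun ω => |h n ω|) := fun n =>
    (abs_nonneg _).trans (abs_simpleIntegral_le μ (H.simple n))
  rw [Metric.tendsto_atTop]
  intro ε hε
  obtain ⟨N, hN⟩ := H.cauchy (ε / 3) (by positivity)
  obtain ⟨M, hM0, hM⟩ : ∃ M : ℝ, 0 < M ∧ ∀ ω, |h N ω| ≤ M := by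
    obtain ⟨M, hM⟩ := ((H.simple N).1.image abs).bddAbove
    exact ⟨max M 1, by positivity, fun ω =>
      le_max_of_le_left (hM ⟨h N ω, ⟨ω, rfl⟩, rfl⟩)⟩
  set δ := ε / (3 * (V + 1)) with hδ
  have hδ0 : 0 < δ := by positivity
  have hδV : δ * V ≤ ε / 3 := by
    rw [hδ, div_mul_eq_mul_div, div_le_div_iff₀ (by positivity) (by positivity)]
    nlinarith
  have ht := H.tendsto_measure δ hδ0
  rw [Metric.tendsto_atTop] at ht
  obtain ⟨N', hN'⟩ := ht (ε / (3 * M)) (by positivity)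
  refine ⟨max N N', fun n hn => ?_⟩
  have h1 := hN n (le_trans (le_max_left _ _) hn) N le_rfl
  have h2 := hN' n (le_trans (le_max_right _ _) hn)
  rw [Real.dist_eq, sub_zero, abs_of_nonneg (hnn n)]
  rw [Real.dist_eq, sub_zero, abs_of_nonneg (outerVariation_nonneg _ _)] at h2
  have hmem : {ω | δ < |h n ω - 0|} ∈ 𝒜 := by
    have hs := ((H.simple n).comp₂ (H.simple n) (fun a _ => if δ < |a - 0| then 1 else 0)).2 1
    convert hs using 1
    ext ω
    simp
  set E : 𝒜 := ⟨_, hmem⟩ with hE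
  have h3 : (variation μ).1 E < ε / (3 * M) := (variation_le_outerVariation μ E).trans_lt h2
  have sE := simple_ite E M 0
  have sT := simple_ite (⊤ : 𝒜) δ 0
  have sd := (H.simple n).comp₂ (H.simple N) (fun a b => |a - b|)
  have h4 := simpleIntegral_mono (variation μ) (variation_nonneg μ) (s0 n)
    ((sd.comp₂ sE.1 (fun a b => a + b)).comp₂ sT.1 (fun a b => a + b)) (fun ω => by
      have hω : ω ∈ ((⊤ : 𝒜) : Set Ω) := trivial
      rw [if_pos hω]
      by_cases hm : ω ∈ (E : Set Ω)
      · rw [if_pos hm]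
        have e1 := hM ω
        have e2 := abs_sub_abs_le_abs_sub (h n ω) (h N ω)
        linarith
      · rw [if_neg hm]
        have e1 : |h n ω - 0| ≤ δ := not_lt.1 hm
        rw [sub_zero] at e1
        have e2 := abs_nonneg (h n ω - h N ω)
        linarith)
  rw [simpleIntegral_add _ (sd.comp₂ sE.1 (fun a b => a + b)) sT.1, simpleIntegral_add _ sd sE.1,
    sE.2, sT.2] at h4
  have h5 : M * (variation μ).1 E < ε / 3 := by
    calc M * (variation μ).1 E < M * (ε / (3 * M)) := mul_lt_mul_of_pos_left h3 hM0
      _ = ε / 3 := by field_simp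
  linarith

lemma abs_simpleIntegral_sub_le (μ : ba 𝒜) {f g : Ω → ℝ} (hf : IsSimple 𝒜 f)
    (hg : IsSimple 𝒜 g) : |simpleIntegral μ f - simpleIntegral μ g| ≤
      simpleIntegral (variation μ) (fun ω => |f ω - g ω|) := by
  have hs := hf.comp₂ hg (fun a b => a - b)
  have h := simpleIntegral_add μ hs hg
  simp only [sub_add_cancel] at h
  rw [show simpleIntegral μ f = _ from h, add_sub_cancel_right]
  exact abs_simpleIntegral_le μ hs

/-- The integral is the limit along every fundamental sequence. -/
lemma tendsto_integral {μ : ba 𝒜} {g : ℕ → Ω → ℝ} {f : Ω → ℝ} (h : IsFundamental μ g f) :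
    Tendsto (fun n => simpleIntegral μ (g n)) atTop (𝓝 (integral μ f)) := by
  have hI : Integrable μ f := ⟨g, h⟩
  have hc := hI.choose_spec
  set k := hI.choose with hk
  have hcau : CauchySeq fun n => simpleIntegral μ (k n) := by
    rw [Metric.cauchySeq_iff]
    intro ε hε
    obtain ⟨N, hN⟩ := hc.cauchy ε hε
    refine ⟨N, fun m hm n hn => ?_⟩
    rw [Real.dist_eq]
    exact (abs_simpleIntegral_sub_le μ (hc.simple m) (hc.simple n)).trans_lt (hN m hm n hn)
  have hlim : Tendsto (fun n => simpleIntegral μ (k n)) atTop (𝓝 (integral μ f)) := by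
    rw [integral, dif_pos hI]
    exact hcau.tendsto_limUnder
  have hd : IsFundamental μ (fun n ω => g n ω - k n ω) (fun _ => 0) := by
    have := h.comp₂ hc (fun a b => a - b) 1 one_pos (fun a b c d => by
      rw [one_mul, show a - b - (c - d) = (a - c) - (b - d) by ring]
      exact abs_sub _ _)
    simpa using this
  have hz : Tendsto (fun n => simpleIntegral μ (g n) - simpleIntegral μ (k n)) atTop (𝓝 0) :=
    squeeze_zero_norm (fun n => abs_simpleIntegral_sub_le μ (h.simple n) (hc.simple n))
      hd.tendsto_zero
  simpa using hz.add hlim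

lemma IsFundamental.variation {μ : ba 𝒜} {g : ℕ → Ω → ℝ} {f : Ω → ℝ} (h : IsFundamental μ g f) :
    IsFundamental (FinAdd.variation μ) g f where
  simple := h.simple
  tendsto_measure := by
    simpa only [outerVariation, variation_variation] using h.tendsto_measure
  cauchy := by simpa only [variation_variation] using h.cauchy

lemma IsFundamental.abs {μ : ba 𝒜} {g : ℕ → Ω → ℝ} {f : Ω → ℝ} (h : IsFundamental μ g f) :
    IsFundamental μ (fun n ω => |g n ω|) (fun ω => |f ω|) :=
  h.comp₂ h (fun a _ => |a|) 1 one_pos fun a b c d => by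
    have h1 := abs_abs_sub_abs_le_abs_sub a c
    have h2 := abs_nonneg (b - d)
    linarith

lemma IsFundamental.add {μ : ba 𝒜} {g g' : ℕ → Ω → ℝ} {f f' : Ω → ℝ}
    (h : IsFundamental μ g f) (h' : IsFundamental μ g' f') :
    IsFundamental μ (fun n ω => g n ω + g' n ω) (fun ω => f ω + f' ω) :=
  h.comp₂ h' (fun a b => a + b) 1 one_pos fun a b c d => by
    rw [one_mul, show a + b - (c + d) = (a - c) + (b - d) by ring]
    exact abs_add_le _ _

lemma IsFundamental.const_mul {μ : ba 𝒜} {g : ℕ → Ω → ℝ} {f : Ω → ℝ} (h : IsFundamental μ g f)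
    (a : ℝ) : IsFundamental μ (fun n ω => a * g n ω) (fun ω => a * f ω) :=
  h.comp₂ h (fun x _ => a * x) (|a| + 1) (by positivity) fun x y c d => by
    rw [← mul_sub, abs_mul]
    nlinarith [abs_nonneg a, abs_nonneg (x - c), abs_nonneg (y - d),
      mul_nonneg (abs_nonneg a) (abs_nonneg (y - d))]

lemma isFundamental_zero (μ : ba 𝒜) : IsFundamental μ (fun _ _ => 0) (fun _ => 0) := by
  classical
  have h0 := simple_ite (⊤ : 𝒜) (0 : ℝ) 0
  simp only [ite_self] at h0
  refine ⟨fun _ => h0.1, fun ε hε => ?_, fun ε hε => ⟨0, fun m _ n _ => ?_⟩⟩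
  · have : outerVariation μ {ω : Ω | ε < |(0 : ℝ) - 0|} = 0 := by
      refine le_antisymm ?_ (outerVariation_nonneg μ _)
      rw [← ba_bot (FinAdd.variation μ)]
      refine outerVariation_le μ fun ω hω => ?_
      simp only [Set.mem_ofPred_eq, sub_self, abs_zero] at hω
      exact absurd hω hε.le.not_gt
    rw [this]
    exact tendsto_const_nhds
  · simpa [h0.2] using hε

end integral

/-! The normed space `L¹`. -/

section LOne

variable {Ω : Type*} {𝒜 : BooleanSubalgebra (Set Ω)}

/-- The vector space of `l`-integrable functions. -/
def integrableFunctions (l : ba 𝒜) : Submodule ℝ (Ω → ℝ) where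
  carrier := {f | Integrable l f}
  add_mem' := fun ⟨_, h⟩ ⟨_, h'⟩ => ⟨_, h.add h'⟩
  zero_mem' := ⟨_, isFundamental_zero l⟩
  smul_mem' := fun a _ ⟨_, h⟩ => ⟨_, h.const_mul a⟩

/-- The `l`-integrable functions, as a type that carries the seminorm `∫ |f| d|l|`. -/
def PreLOne (l : ba 𝒜) : Type _ := ↥(integrableFunctions l)

instance (l : ba 𝒜) : AddCommGroup (PreLOne l) :=
  inferInstanceAs (AddCommGroup ↥(integrableFunctions l))

instance (l : ba 𝒜) : Module ℝ (PreLOne l) :=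
  inferInstanceAs (Module ℝ ↥(integrableFunctions l))

/-- An integrable function, as an element of `PreLOne l`. -/
def PreLOne.mk {l : ba 𝒜} (f : Ω → ℝ) (hf : Integrable l f) : PreLOne l := ⟨f, hf⟩

/-- The underlying function of an element of `PreLOne l`. -/
def PreLOne.toFun {l : ba 𝒜} (f : PreLOne l) : Ω → ℝ := f.1

lemma PreLOne.tendsto_abs {l : ba 𝒜} (f : PreLOne l) {g : ℕ → Ω → ℝ}
    (h : IsFundamental l g f.toFun) :
    Tendsto (fun n => simpleIntegral (variation l) fun ω => |g n ω|) atTop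
      (𝓝 (integral (variation l) fun ω => |f.toFun ω|)) :=
  tendsto_integral h.variation.abs

/-- The seminorm `∫ |f| d|l|`. -/
def PreLOne.seminorm (l : ba 𝒜) : Seminorm ℝ (PreLOne l) :=
  Seminorm.ofSMulLE (fun f => integral (variation l) fun ω => |f.toFun ω|)
    (by
      have h := tendsto_integral (isFundamental_zero l).variation.abs
      have e : ∀ n : ℕ, simpleIntegral (variation l) (fun _ : Ω => |(0 : ℝ)|) = 0 := fun _ => by
        classical
        have h0 := (simple_ite (⊤ : 𝒜) (0 : ℝ) 0).2 (variation l)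
        simpa using h0
      exact tendsto_nhds_unique h (tendsto_const_nhds.congr fun n => (e n).symm))
    (fun f f' => by
      obtain ⟨g, h⟩ := f.2
      obtain ⟨g', h'⟩ := f'.2
      refine le_of_tendsto_of_tendsto' (PreLOne.tendsto_abs (f + f') (h.add h'))
        ((f.tendsto_abs h).add (f'.tendsto_abs h')) fun n => ?_
      rw [← simpleIntegral_add _ (h.abs.simple n) (h'.abs.simple n)]
      exact simpleIntegral_mono _ (variation_nonneg l) ((h.add h').abs.simple n)
        ((h.abs.add h'.abs).simple n) fun ω => abs_add_le _ _)
    (fun a f => by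
      obtain ⟨g, h⟩ := f.2
      refine le_of_tendsto_of_tendsto' (PreLOne.tendsto_abs (a • f) (h.const_mul a))
        ((f.tendsto_abs h).const_mul ‖a‖) fun n => ?_
      rw [← simpleIntegral_const_mul _ _ (h.abs.simple n)]
      simp only [abs_mul, Real.norm_eq_abs, le_refl])

instance (l : ba 𝒜) : SeminormedAddCommGroup (PreLOne l) :=
  (PreLOne.seminorm l).toAddGroupSeminorm.toSeminormedAddCommGroup

lemma PreLOne.norm_def {l : ba 𝒜} (f : PreLOne l) :
    ‖f‖ = integral (variation l) fun ω => |f.toFun ω| := rfl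

instance (l : ba 𝒜) : NormedSpace ℝ (PreLOne l) where
  norm_smul_le a f := ((PreLOne.seminorm l).smul' a f).le

/-- `L¹(l)`: the `l`-integrable functions with norm `∫ |f| d|l|`, functions at distance `0` (that
is, differing by a null function) being identified. -/
abbrev LOne (l : ba 𝒜) : Type _ := SeparationQuotient (PreLOne l)

/-- The class in `L¹(l)` of an `l`-integrable function. -/
def LOne.mk {l : ba 𝒜} (f : Ω → ℝ) (hf : Integrable l f) : LOne l :=
  SeparationQuotient.mk (PreLOne.mk f hf)

end LOne

end FinAdd

end

open Filter Topology

noncomputable section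

namespace FinAdd

variable {Ω : Type*} {𝒜 : BooleanSubalgebra (Set Ω)}

/-! A functional `φ` on `L¹(l)` can only correspond to `μ(A) = φ(1_A)`, and two facts make this work
without countable additivity, completeness of `L¹(l)` or a Radon–Nikodym density.

Since `‖1_A‖ = |l|(A)`, disjoint `E i ⊆ A` satisfy `∑ |φ(1_{E i})| ≤ ‖φ‖ ∑ |l|(E i) ≤ ‖φ‖ |l|(A)`,
so that `|μ| ≤ ‖φ‖ |l|` (`variation_dualToBa_le`).

Conversely, `|μ| ≤ c |l|` passes to outer measures and to integrals of nonnegative simple functions.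
Hence a sequence that determines `f` for `l` also determines it for `μ`
(`IsFundamental.of_variation_le`), and in the limit `|∫ f dμ| ≤ c ∫ |f| d|l|`
(`PreLOne.abs_integral_le`).

Simple functions are dense in `L¹(l)` (`IsFundamental.tendsto_mk`), and by linearity `φ` is
integration against `μ` on them, hence everywhere (`dual_apply`). The two estimates, one for each
direction, give the isometry. -/

/-! ### Simple functions as integrable functions -/

lemma IsSimple.isFundamental_const {f : Ω → ℝ} (hf : IsSimple 𝒜 f) (μ : ba 𝒜) :
    IsFundamental μ (fun _ => f) f where
  simple _ := hf
  tendsto_measure ε hε := by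
    -- All differences vanish identically, so the conditions are those for the zero sequence.
    simpa only [sub_self] using (isFundamental_zero (Ω := Ω) μ).tendsto_measure ε hε
  cauchy ε hε := by
    simpa only [sub_self] using (isFundamental_zero (Ω := Ω) μ).cauchy ε hε

lemma IsSimple.integrable {f : Ω → ℝ} (hf : IsSimple 𝒜 f) (μ : ba 𝒜) : Integrable μ f :=
  ⟨_, hf.isFundamental_const μ⟩

lemma IsSimple.integral_eq {f : Ω → ℝ} (hf : IsSimple 𝒜 f) (μ : ba 𝒜) :
    integral μ f = simpleIntegral μ f :=
  tendsto_nhds_unique (tendsto_integral (hf.isFundamental_const μ)) tendsto_const_nhds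

/-! ### Domination of set functions and its effect on integrals -/

/-- Integrals of nonnegative simple functions are monotone in the set function. -/
lemma simpleIntegral_le_mul {μ ν : ba 𝒜} {c : ℝ} (h : ∀ A, μ.1 A ≤ c * ν.1 A) {f : Ω → ℝ}
    (hf : IsSimple 𝒜 f) (h0 : ∀ ω, 0 ≤ f ω) : simpleIntegral μ f ≤ c * simpleIntegral ν f := by
  obtain ⟨ι, _, E, a, -, hE, hcov, ha, -⟩ := exists_partition hf hf
  rw [(simple_of_partition E hE hcov a f ha).2, (simple_of_partition E hE hcov a f ha).2,
    Finset.mul_sum]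
  refine Finset.sum_le_sum fun i _ => ?_
  -- On an empty cell the sign of `a i` is unknown, but both set functions vanish there.
  rcases Set.eq_empty_or_nonempty (E i : Set Ω) with he | ⟨ω, hω⟩
  · have : E i = ⊥ := Subtype.ext he
    rw [this, ba_bot, ba_bot]
    simp
  · rw [mul_left_comm]
    exact mul_le_mul_of_nonneg_left (h _) (ha i ω hω ▸ h0 ω)

lemma outerVariation_le_mul {μ ν : ba 𝒜} {c : ℝ} (hc : 0 ≤ c)
    (h : ∀ A, (variation μ).1 A ≤ c * (variation ν).1 A) (S : Set Ω) :
    outerVariation μ S ≤ c * outerVariation ν S := by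
  -- The infimum need not be attained, so nearly optimal covers are used. Letting `ε → 0` after
  -- multiplying by `c`, instead of dividing by `c`, covers `c = 0`.
  have hlim : Tendsto (fun ε : ℝ => c * (outerVariation ν S + ε)) (𝓝[>] 0)
      (𝓝 (c * (outerVariation ν S + 0))) :=
    ((continuous_const.mul (continuous_const.add continuous_id)).tendsto (0 : ℝ)).mono_left
      nhdsWithin_le_nhds
  rw [add_zero] at hlim
  refine ge_of_tendsto hlim ?_
  filter_upwards [self_mem_nhdsWithin] with ε hε
  obtain ⟨A, hA, hA'⟩ := exists_outerVariation_lt ν S hε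
  exact (outerVariation_le μ hA).trans ((h A).trans (mul_le_mul_of_nonneg_left hA'.le hc))

/-- Both the outer measure and the mean distance for `μ` are at most `c` times those for `l`, so the
same sequence serves both set functions. -/
lemma IsFundamental.of_variation_le {μ l : ba 𝒜} {c : ℝ} (hc : 0 ≤ c)
    (h : ∀ A, (FinAdd.variation μ).1 A ≤ c * (FinAdd.variation l).1 A) {g : ℕ → Ω → ℝ} {f : Ω → ℝ}
    (H : IsFundamental l g f) : IsFundamental μ g f where
  simple := H.simple
  tendsto_measure ε hε := by
    refine squeeze_zero (fun n => outerVariation_nonneg μ _)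
      (fun n => outerVariation_le_mul hc h _) ?_
    simpa using (H.tendsto_measure ε hε).const_mul c
  cauchy ε hε := by
    -- The denominator is `c + 1` because `c` may be zero; passing from `c` to `c + 1` is harmless
    -- as the integral is nonnegative (`h3`).
    obtain ⟨N, hN⟩ := H.cauchy (ε / (c + 1)) (by positivity)
    refine ⟨N, fun m hm n hn => ?_⟩
    have hs := (H.simple m).comp₂ (H.simple n) (fun a b => |a - b|)
    have h1 := simpleIntegral_le_mul h hs fun ω => abs_nonneg _
    have h2 := hN m hm n hn
    rw [lt_div_iff₀ (by positivity)] at h2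
    have h3 : 0 ≤ simpleIntegral (FinAdd.variation l) fun ω => |g m ω - g n ω| :=
      (abs_nonneg _).trans
        (abs_simpleIntegral_le l ((H.simple m).comp₂ (H.simple n) (fun a b => a - b)))
    nlinarith

lemma Integrable.of_variation_le {μ l : ba 𝒜} {c : ℝ} (hc : 0 ≤ c)
    (h : ∀ A, (variation μ).1 A ≤ c * (variation l).1 A) {f : Ω → ℝ} (hf : Integrable l f) :
    Integrable μ f :=
  let ⟨g, H⟩ := hf
  ⟨g, H.of_variation_le hc h⟩

lemma integral_add {μ : ba 𝒜} {f g : Ω → ℝ} (hf : Integrable μ f) (hg : Integrable μ g) :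
    integral μ (fun ω => f ω + g ω) = integral μ f + integral μ g := by
  obtain ⟨F, hF⟩ := hf
  obtain ⟨G, hG⟩ := hg
  refine tendsto_nhds_unique (tendsto_integral (hF.add hG)) ?_
  simp only [simpleIntegral_add μ (hF.simple _) (hG.simple _)]
  exact (tendsto_integral hF).add (tendsto_integral hG)

lemma integral_const_mul {μ : ba 𝒜} (a : ℝ) {f : Ω → ℝ} (hf : Integrable μ f) :
    integral μ (fun ω => a * f ω) = a * integral μ f := by
  obtain ⟨F, hF⟩ := hf
  refine tendsto_nhds_unique (tendsto_integral (hF.const_mul a)) ?_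
  simp only [simpleIntegral_const_mul μ a (hF.simple _)]
  exact (tendsto_integral hF).const_mul a

/-- Along a fundamental sequence `|∫ g dμ| ≤ ∫ |g| d|μ| ≤ c ∫ |g| d|l|`, and both ends converge.
This yields both the continuity of integration and the upper bound for the dual norm. -/
lemma PreLOne.abs_integral_le {μ l : ba 𝒜} {c : ℝ} (hc : 0 ≤ c)
    (h : ∀ A, (variation μ).1 A ≤ c * (variation l).1 A) (f : PreLOne l) :
    |integral μ f.toFun| ≤ c * ‖f‖ := by
  obtain ⟨g, H⟩ := f.2
  refine le_of_tendsto_of_tendsto' (tendsto_integral (H.of_variation_le hc h)).abs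
    ((f.tendsto_abs H).const_mul c) fun n => ?_
  exact (abs_simpleIntegral_le μ (H.simple n)).trans
    (simpleIntegral_le_mul h (H.abs.simple n) fun ω => abs_nonneg _)

/-! ### Density of simple functions, and integration as a functional -/

/-- A fundamental sequence converges in mean. -/
lemma IsFundamental.tendsto_mk {l : ba 𝒜} {g : ℕ → Ω → ℝ} {f : Ω → ℝ} (H : IsFundamental l g f) :
    Tendsto (fun n => LOne.mk (g n) ((H.simple n).integrable l)) atTop (𝓝 (LOne.mk f ⟨g, H⟩)) := by
  refine (SeparationQuotient.continuous_mk.tendsto _).comp ?_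
  rw [Metric.tendsto_atTop]
  intro ε hε
  obtain ⟨N, hN⟩ := H.cauchy (ε / 2) (half_pos hε)
  refine ⟨N, fun n hn => ?_⟩
  -- With `n` fixed, `g n - g m` is fundamental in `m` for `g n - f`. So `‖g n - f‖` is the limit of
  -- `∫ |g n - g m| d|l|`, which the Cauchy condition keeps below `ε / 2`.
  have hd : IsFundamental l (fun m ω => g n ω - g m ω) (fun ω => g n ω - f ω) :=
    ((H.simple n).isFundamental_const l).comp₂ H (fun a b => a - b) 1 one_pos fun a b c d => by
      rw [one_mul, show a - b - (c - d) = (a - c) - (b - d) by ring]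
      exact abs_sub _ _
  rw [dist_eq_norm]
  refine lt_of_le_of_lt ?_ (half_lt_self hε)
  refine le_of_tendsto (PreLOne.tendsto_abs (PreLOne.mk (g n) ((H.simple n).integrable l) -
    PreLOne.mk f ⟨g, H⟩) hd) ?_
  filter_upwards [eventually_ge_atTop N] with m hm
  exact (hN n hn m hm).le

/-- Integration with respect to `μ ∈ ba_∞(𝒜, l)`, as a continuous functional on `L¹(l)`. -/
def integralCLM {l : ba 𝒜} (μ : baInfty l) : StrongDual ℝ (LOne l) :=
  SeparationQuotient.liftCLM
    (LinearMap.mkContinuousOfExistsBound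
      { toFun := fun f : PreLOne l => integral μ.1 f.toFun
        map_add' := fun f g => by
          obtain ⟨c, hc, h⟩ := μ.2
          exact integral_add (Integrable.of_variation_le hc.le h f.2)
            (Integrable.of_variation_le hc.le h g.2)
        map_smul' := fun a f => by
          obtain ⟨c, hc, h⟩ := μ.2
          exact integral_const_mul a (Integrable.of_variation_le hc.le h f.2) }
      (by
        obtain ⟨c, hc, h⟩ := μ.2
        exact ⟨c, PreLOne.abs_integral_le hc.le h⟩))
    -- Identified functions are inseparable, and a continuous map into the Hausdorff space `ℝ`
    -- cannot tell them apart.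
    fun _ _ hxy => (hxy.map (ContinuousLinearMap.continuous _)).eq

/-! ### Indicators in `L¹` -/

lemma isSimple_indicator (A : 𝒜) (a : ℝ) : IsSimple 𝒜 ((A : Set Ω).indicator fun _ => a) := by
  classical
  convert (simple_ite A a 0).1 using 2 with ω
  exact Set.indicator_apply _ _ ω

lemma simpleIntegral_indicator (μ : ba 𝒜) (A : 𝒜) (a : ℝ) :
    simpleIntegral μ ((A : Set Ω).indicator fun _ => a) = a * μ.1 A := by
  classical
  have h := (simple_ite A a 0).2 μ
  rw [zero_mul, add_zero] at h
  rw [← h]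
  exact congrArg _ (funext fun ω => Set.indicator_apply _ _ ω)

/-- The class in `L¹(l)` of the indicator function of a member of `𝒜`. -/
def indicatorLOne (l : ba 𝒜) (A : 𝒜) : LOne l :=
  LOne.mk _ ((isSimple_indicator A 1).integrable l)

/-- This turns bounds by `‖φ‖` on indicators into bounds by `|l|`. -/
lemma norm_indicatorLOne (l : ba 𝒜) (A : 𝒜) : ‖indicatorLOne l A‖ = (variation l).1 A := by
  have h : (fun ω => |(A : Set Ω).indicator (fun _ => (1 : ℝ)) ω|) =
      (A : Set Ω).indicator fun _ => 1 := by
    funext ω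
    exact abs_of_nonneg (Set.indicator_nonneg (fun _ _ => zero_le_one) ω)
  change integral (variation l) (fun ω => |(A : Set Ω).indicator (fun _ => (1 : ℝ)) ω|) = _
  rw [h, (isSimple_indicator A 1).integral_eq, simpleIntegral_indicator, one_mul]

lemma indicatorLOne_sup (l : ba 𝒜) {A B : 𝒜} (h : Disjoint A B) :
    indicatorLOne l (A ⊔ B) = indicatorLOne l A + indicatorLOne l B :=
  congrArg SeparationQuotient.mk (Subtype.ext (Set.indicator_union_of_disjoint (disjoint_coe h) _))

/-- The expansion already holds pointwise, since each point lies in exactly one cell; it is then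
carried through the linear quotient map. -/
lemma LOne.mk_simple (l : ba 𝒜) {ι : Type*} [Fintype ι] (E : ι → 𝒜)
    (hE : Pairwise fun i j => Disjoint (E i) (E j)) (hcov : ∀ ω, ∃ i, ω ∈ (E i : Set Ω))
    (c : ι → ℝ) {f : Ω → ℝ} (hf : ∀ i, ∀ ω ∈ (E i : Set Ω), f ω = c i) (hI : Integrable l f) :
    LOne.mk f hI = ∑ i, c i • indicatorLOne l (E i) := by
  have h : PreLOne.mk f hI =
      ∑ i, c i • PreLOne.mk _ ((isSimple_indicator (E i) 1).integrable l) := by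
    have e : f = ∑ i, c i • (E i : Set Ω).indicator fun _ => (1 : ℝ) := by
      funext ω
      obtain ⟨i, hi⟩ := hcov ω
      rw [Finset.sum_apply, Finset.sum_eq_single i]
      · simp [hf i ω hi, hi]
      · intro j _ hj
        have : ω ∉ (E j : Set Ω) := fun hω =>
          Set.disjoint_left.1 (disjoint_coe (hE hj)) hω hi
        simp [this]
      · simp
    refine Subtype.ext (e.trans ?_)
    -- Inclusion into the space of all functions, used as a linear map so that it commutes with the
    -- finite sum.
    let T : PreLOne l →ₗ[ℝ] (Ω → ℝ) := (integrableFunctions l).subtype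
    exact (map_sum T (fun i => c i • PreLOne.mk _ ((isSimple_indicator (E i) 1).integrable l))
      Finset.univ).symm
  change SeparationQuotient.mkCLM ℝ (PreLOne l) (PreLOne.mk f hI) = _
  rw [h, map_sum]
  rfl

/-! ### Functionals as set functions -/

/-- The set function `A ↦ φ(1_A)` of a functional `φ` on `L¹(l)`. -/
def dualToBa {l : ba 𝒜} (φ : StrongDual ℝ (LOne l)) : ba 𝒜 :=
  ⟨fun A => φ (indicatorLOne l A), fun A B h => by
    simp only [indicatorLOne_sup l h, map_add], by
    refine ⟨‖φ‖ * (variation l).1 ⊤, fun A => (φ.le_opNorm _).trans ?_⟩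
    rw [norm_indicatorLOne]
    exact mul_le_mul_of_nonneg_left (variation_mono l le_top) (norm_nonneg φ)⟩

/-- Each term is at most `‖φ‖ |l|(E i)`. Additivity of `|l|` collects these into the value at the
union, which lies inside `A`. -/
lemma variation_dualToBa_le {l : ba 𝒜} (φ : StrongDual ℝ (LOne l)) (A : 𝒜) :
    (variation (dualToBa φ)).1 A ≤ ‖φ‖ * (variation l).1 A := by
  refine variationFun_le _ _ _ fun n E hE hA => ?_
  calc ∑ i, |φ (indicatorLOne l (E i))| ≤ ∑ i, ‖φ‖ * (variation l).1 (E i) :=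
        Finset.sum_le_sum fun i _ => norm_indicatorLOne l (E i) ▸ φ.le_opNorm _
    _ = ‖φ‖ * (variation l).1 (Finset.univ.sup E) := by
        rw [← Finset.mul_sum, ba_sup _ _ _ fun i _ j _ h => hE h]
    _ ≤ _ := mul_le_mul_of_nonneg_left
        (variation_mono l (Finset.sup_le fun i _ => hA i)) (norm_nonneg φ)

lemma dual_apply_simple {l : ba 𝒜} (φ : StrongDual ℝ (LOne l)) {f : Ω → ℝ} (hf : IsSimple 𝒜 f) :
    φ (LOne.mk f (hf.integrable l)) = simpleIntegral (dualToBa φ) f := by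
  obtain ⟨ι, _, E, c, -, hE, hcov, hc, -⟩ := exists_partition hf hf
  rw [LOne.mk_simple l E hE hcov c hc, (simple_of_partition E hE hcov c f hc).2, map_sum]
  simp only [map_smul, smul_eq_mul]
  rfl

/-- Both sides are limits along one sequence that is fundamental for `l`: the left by continuity of
`φ` and convergence in mean, the right because the sequence is also fundamental for `dualToBa φ`. -/
lemma dual_apply {l : ba 𝒜} (φ : StrongDual ℝ (LOne l)) {f : Ω → ℝ} (hf : Integrable l f) :
    φ (LOne.mk f hf) = integral (dualToBa φ) f := by
  obtain ⟨g, H⟩ := hf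
  refine tendsto_nhds_unique ((φ.continuous.tendsto _).comp H.tendsto_mk) ?_
  refine (tendsto_integral
    (H.of_variation_le (norm_nonneg φ) (variation_dualToBa_le φ))).congr fun n => ?_
  exact (dual_apply_simple φ (H.simple n)).symm

/-- The isomorphism of `L¹(l)*` onto `ba_∞(𝒜, l)`, with inverse given by integration. -/
def dualEquiv (l : ba 𝒜) : StrongDual ℝ (LOne l) ≃ₗ[ℝ] baInfty l where
  -- `baInfty` asks for a strictly positive constant, which `‖φ‖` is not when `φ = 0`.
  toFun φ := ⟨dualToBa φ, ‖φ‖ + 1, by positivity, fun A => by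
    linarith [variation_dualToBa_le φ A, variation_nonneg l A]⟩
  map_add' _ _ := rfl
  map_smul' _ _ := rfl
  invFun := integralCLM
  left_inv φ := by
    ext x
    obtain ⟨f, rfl⟩ := SeparationQuotient.surjective_mk x
    exact (dual_apply φ f.2).symm
  right_inv μ := by
    refine Subtype.ext (Subtype.ext (funext fun A => ?_))
    -- Integrating the indicator of `A` recovers `μ(A)`.
    change integral μ.1 ((A : Set Ω).indicator fun _ => 1) = μ.1.1 A
    rw [(isSimple_indicator A 1).integral_eq, simpleIntegral_indicator, one_mul]

lemma isLeast_norm_dual {l : ba 𝒜} (φ : StrongDual ℝ (LOne l)) :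
    IsLeast {c : ℝ | 0 ≤ c ∧ ∀ A : 𝒜, (variation (dualToBa φ)).1 A ≤ c * (variation l).1 A}
      ‖φ‖ := by
  refine ⟨⟨norm_nonneg φ, variation_dualToBa_le φ⟩, fun c hc => ?_⟩
  -- By `dual_apply`, `φ` is integration against `dualToBa φ`, so every admissible `c` bounds `φ` on
  -- all of `L¹(l)`.
  refine φ.opNorm_le_bound hc.1 fun x => ?_
  obtain ⟨f, rfl⟩ := SeparationQuotient.surjective_mk x
  rw [SeparationQuotient.norm_mk]
  exact (congrArg abs (dual_apply φ f.2)).trans_le (PreLOne.abs_integral_le hc.1 hc.2 f)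

end FinAdd

end

theorem corollary4p2 {Ω : Type*} (𝒜 : BooleanSubalgebra (Set Ω)) (l : FinAdd.ba 𝒜) :
    ∃ e : StrongDual ℝ (FinAdd.LOne l) ≃ₗ[ℝ] FinAdd.baInfty l,
      ∀ φ : StrongDual ℝ (FinAdd.LOne l),
        (∀ (f : Ω → ℝ) (hf : FinAdd.Integrable l f),
          FinAdd.Integrable (e φ : FinAdd.ba 𝒜) f ∧
            φ (FinAdd.LOne.mk f hf) = FinAdd.integral (e φ : FinAdd.ba 𝒜) f) ∧
        IsLeast {c : ℝ | 0 ≤ c ∧ ∀ A : 𝒜, (FinAdd.variation (e φ : FinAdd.ba 𝒜)).1 A ≤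
          c * (FinAdd.variation l).1 A} ‖φ‖ :=
  ⟨FinAdd.dualEquiv l, fun φ =>
    ⟨fun _ hf => ⟨hf.of_variation_le (norm_nonneg φ) (FinAdd.variation_dualToBa_le φ),
      FinAdd.dual_apply φ hf⟩, FinAdd.isLeast_norm_dual φ⟩⟩
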